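/- A Dyck path of semilength $n$ is a word of $n$ up steps $U$ and $n$ down steps $D$ in which every prefix has at least as many $U$'s as $D$'s; a factor is a block of consecutive steps. For $n\ge 1$ let $F_n^\infty$ be the set of Dyck paths of semilength $n$ without the factor $DUU$, and for a positive integer $p$ let $F_n^p$ be the set of those which moreover do not contain the factor $D^{p+1}$ (these sets are counted by the generalized Fibonacci numbers). Order them by the Stanley order: $P\le Q$ if for every $l$ the prefix of length $l$ of $P$ has at most as many up steps as that of $Q$. A graph here is a set with a reflexive symmetric edge relation; each finite poset is viewed as the graph given by its Hasse diagram together with all loops. An epimorphism of graphs maps edges to edges and is surjective on vertices and on edges. A set of vertices of a graph with a topology is connected if it is not the union of two nonempty disjoint relatively closed sets with no edge between them (finite graphs carry the discrete topology). A (continuous) epimorphism is monotone if preimages of closed connected sets are connected. A projective Fraïssé family is a nonempty family of finite graphs with a fixed family of epimorphisms between them such that: any subfamily of pairwise non-isomorphic members is countable; the epimorphisms are closed under composition and contain the identities; for all members $B,C$ there are epimorphisms of the family $D\to B$ and $D\to C$ from a common member $D$; and for all epimorphisms $f:B\to A$, $g:C\to A$ of the family there are epimorphisms $f_0:D\to B$,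 $g_0:D\to C$ of the family with $f\circ f_0=g\circ g_0$. **Theorem.** Let $p\in\{1,2,3,\dots\}\cup\{\infty\}$. Then every $F_n^p$ $(n\ge1)$ is a lattice under the Stanley order. Deleting the first peak $UD$ of a path defines maps $F_{n+1}^p\to F_n^p$ $(n\ge 1)$, and these bonding maps are monotone epimorphisms of graphs. The graphs $F_n^p$ $(n\ge1)$, with the identities and all composites of the bonding maps, form a projective Fraïssé family, all of whose epimorphisms are monotone. The inverse limit $\varprojlim_n F_n^p$ — a subspace of the product of the discrete spaces $F_n^p$, with two points joined by an edge iff all their coordinates are — is a topological graph (its vertex space is compact, zero-dimensional and second countable, and its edge relation is closed) and is Kelley: it is nonempty and connected, and for every nonempty closed connected set $K$ of vertices, every $x\in K$ and every sequence $x_k\to x$ there are closed connected sets $K_k$ with $x_k\in K_k$ and $K_k\to K$ in the Hausdorff metric. -/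

import Mathlib

/-! ### Graphs, topological graphs and epimorphisms -/

/-- A graph: a set of vertices with a reflexive and symmetric edge relation. -/
structure ReflGraph (V : Type*) where
  Edge : V → V → Prop
  refl : ∀ a, Edge a a
  symm : ∀ a b, Edge a b → Edge b a

namespace ReflGraph

variable {V W : Type*}

/-- An epimorphism: a map sending edges to edges, surjective on vertices and on edges. -/
structure IsEpimorphism (G : ReflGraph V) (H : ReflGraph W) (f : V → W) : Prop where
  map_edge : ∀ a b, G.Edge a b → H.Edge (f a) (f b)
  surj_vertex : ∀ c, ∃ a, f a = c
  surj_edge : ∀ c d, H.Edge c d → ∃ a b, G.Edge a b ∧ f a = c ∧ f b = d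

/-- Two graphs are isomorphic if there is an injective epimorphism between them. -/
def Isomorphic (G : ReflGraph V) (H : ReflGraph W) : Prop :=
  ∃ f : V → W, G.IsEpimorphism H f ∧ Function.Injective f

/-- A set `S` of vertices of a topological graph is connected if it is not the union of two
nonempty disjoint relatively closed subsets with no edge between them. -/
def ConnectedSet [TopologicalSpace V] (G : ReflGraph V) (S : Set V) : Prop :=
  ¬ ∃ A B : Set V, IsClosed A ∧ IsClosed B ∧ S ⊆ A ∪ B ∧ (S ∩ A).Nonempty ∧ (S ∩ B).Nonempty ∧
    Disjoint (S ∩ A) (S ∩ B) ∧ ∀ a ∈ S ∩ A, ∀ b ∈ S ∩ B, ¬ G.Edge a b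

/-- A monotone epimorphism of topological graphs: a continuous epimorphism for which preimages of
closed connected sets are connected. -/
structure IsMonotoneEpi [TopologicalSpace V] [TopologicalSpace W] (G : ReflGraph V)
    (H : ReflGraph W) (f : V → W) : Prop where
  continuous : Continuous f
  epi : G.IsEpimorphism H f
  monotone : ∀ Q : Set W, IsClosed Q → H.ConnectedSet Q → G.ConnectedSet (f ⁻¹' Q)

/-- A topological graph: the vertex space is zero-dimensional, compact and second countable, and
the edge relation is closed. (For compact Hausdorff spaces, zero-dimensional is the same as totally
disconnected.) -/
structure IsTopologicalGraph [TopologicalSpace V] (G : ReflGraph V) : Prop where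
  compact : CompactSpace V
  t2 : T2Space V
  zero_dim : TotallyDisconnectedSpace V
  second_countable : SecondCountableTopology V
  closed_edge : IsClosed {e : V × V | G.Edge e.1 e.2}

/-- A topological graph is Kelley if it is nonempty and connected and, for every nonempty closed
connected `K`, every `x ∈ K` and every sequence `xs k → x`, there are closed connected sets
`Ks k ∋ xs k` converging to `K` in the Vietoris (Hausdorff metric) topology. -/
structure IsKelley [TopologicalSpace V] (G : ReflGraph V) : Prop where
  topGraph : G.IsTopologicalGraph
  nonempty : Nonempty V
  connected : G.ConnectedSet Set.univ
  kelley : ∀ K : TopologicalSpace.NonemptyCompacts V, G.ConnectedSet (K : Set V) →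
    ∀ x ∈ K, ∀ xs : ℕ → V, Filter.Tendsto xs Filter.atTop (nhds x) →
      ∃ Ks : ℕ → TopologicalSpace.NonemptyCompacts V,
        (∀ k, G.ConnectedSet (Ks k : Set V) ∧ xs k ∈ Ks k) ∧
        Filter.Tendsto Ks Filter.atTop (nhds K)

/-- The Hasse diagram of a partial order, with the degenerate edges (loops) added. -/
def hasse (α : Type*) [PartialOrder α] : ReflGraph α where
  Edge a b := a = b ∨ a ⋖ b ∨ b ⋖ a
  refl _ := Or.inl rfl
  symm _ _ h := h.elim (fun h => Or.inl h.symm) (fun h => Or.inr h.symm)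

/-- A projective Fraïssé family: a nonempty family `G` of finite graphs together with a fixed
family `M` of epimorphisms among them, satisfying the four axioms. -/
structure IsProjectiveFraisse {ι : Type*} {V : ι → Type*} (G : ∀ i, ReflGraph (V i))
    (M : ∀ i j, Set (V i → V j)) : Prop where
  nonempty : Nonempty ι
  finite : ∀ i, Finite (V i)
  epi : ∀ i j, ∀ f ∈ M i j, (G i).IsEpimorphism (G j) f
  countable : ∀ S : Set ι, S.Pairwise (fun i j => ¬ (G i).Isomorphic (G j)) → S.Countable
  id_mem : ∀ i, id ∈ M i i
  comp_mem : ∀ i j k, ∀ f ∈ M i j, ∀ g ∈ M j k, g ∘ f ∈ M i k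
  joint : ∀ b c, ∃ d, (∃ f, f ∈ M d b) ∧ (∃ g, g ∈ M d c)
  amalgamation : ∀ a b c, ∀ f ∈ M b a, ∀ g ∈ M c a,
    ∃ d, ∃ f₀ ∈ M d b, ∃ g₀ ∈ M d c, f ∘ f₀ = g ∘ g₀

end ReflGraph

/-! ### Inverse sequences -/

namespace InvSeq

variable {V : ℕ → Type*}

/-- The identities and the finite composites `α n ∘ ⋯ ∘ α (m - 1) : V m → V n` of the bonding
maps of an inverse sequence. -/
inductive IsComposite (α : ∀ n, V (n + 1) → V n) : ∀ m n, (V m → V n) → Prop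
  | id (n : ℕ) : IsComposite α n n id
  | comp (m n : ℕ) (f : V m → V n) : IsComposite α m n f → IsComposite α (m + 1) n (f ∘ α m)

/-- The set of all composites `V m → V n` of bonding maps. -/
def Composites (α : ∀ n, V (n + 1) → V n) (m n : ℕ) : Set (V m → V n) :=
  {f | IsComposite α m n f}

/-- The inverse limit of an inverse sequence. -/
def Limit (α : ∀ n, V (n + 1) → V n) : Type _ :=
  {x : ∀ n, V n // ∀ n, α n (x (n + 1)) = x n}

/-- The inverse limit is topologized as a subspace of the product. -/
instance [∀ n, TopologicalSpace (V n)] (α : ∀ n, V (n + 1) → V n) :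
    TopologicalSpace (Limit α) :=
  instTopologicalSpaceSubtype

/-- The graph on the inverse limit: two points span an edge iff all their coordinates do. -/
def limitGraph (G : ∀ n, ReflGraph (V n)) (α : ∀ n, V (n + 1) → V n) :
    ReflGraph (Limit α) where
  Edge x y := ∀ n, (G n).Edge (x.1 n) (y.1 n)
  refl x n := (G n).refl (x.1 n)
  symm _ _ h n := (G n).symm _ _ (h n)

end InvSeq

/-! ### The Fibonacci families of Dyck paths -/

/-- The set `F_n^p` of Dyck paths of semilength `n` with no factor `DUU` and no factor `D^{p+1}`
(a factor consists of consecutive steps). For `p = ⊤` the second condition is void: this is the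
set `F_n^∞` of Dyck paths of semilength `n` with no factor `DUU`. -/
@[ext]
structure FibPath (p : ℕ∞) (n : ℕ) where
  word : DyckWord
  semilength_eq : word.semilength = n
  avoids_DUU : ¬ [DyckStep.D, DyckStep.U, DyckStep.U] <:+: word.toList
  avoids_D : ∀ k : ℕ, (k : ℕ∞) = p + 1 → ¬ List.replicate k DyckStep.D <:+: word.toList

/-- Lists of steps of equal length are equal if all their prefixes have equally many `U`s. -/
theorem list_eq_of_count_take : ∀ (l₁ l₂ : List DyckStep), l₁.length = l₂.length →
    (∀ i, (l₁.take i).count DyckStep.U = (l₂.take i).count DyckStep.U) → l₁ = l₂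
  | [], [], _, _ => rfl
  | [], _ :: _, h, _ => by simp at h
  | _ :: _, [], h, _ => by simp at h
  | a :: l₁, b :: l₂, h, hc => by
    have h1 := hc 1
    have hab : a = b := by cases a <;> cases b <;> simp at h1 ⊢
    subst hab
    congr 1
    refine list_eq_of_count_take l₁ l₂ (by simpa using h) fun i => ?_
    have := hc (i + 1)
    simpa [List.count_cons] using this

namespace FibPath

/-- The Stanley order: `P ≤ Q` iff `P` lies weakly below `Q`, i.e. every prefix of `P` has at most
as many up steps as the prefix of `Q` of the same length. -/
instance (p : ℕ∞) (n : ℕ) : PartialOrder (FibPath p n) where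
  le P Q := ∀ l : ℕ, (P.word.toList.take l).count DyckStep.U ≤
    (Q.word.toList.take l).count DyckStep.U
  le_refl _ _ := le_rfl
  le_trans _ _ _ h₁ h₂ l := (h₁ l).trans (h₂ l)
  le_antisymm P Q h₁ h₂ := by
    apply FibPath.ext
    apply DyckWord.ext
    apply list_eq_of_count_take
    · rw [← DyckWord.two_mul_semilength_eq_length, ← DyckWord.two_mul_semilength_eq_length,
        P.semilength_eq, Q.semilength_eq]
    · exact fun i => le_antisymm (h₁ i) (h₂ i)

/-- The finite vertex sets carry the discrete topology. -/
instance (p : ℕ∞) (n : ℕ) : TopologicalSpace (FibPath p n) := ⊥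

end FibPath

/-- Delete the first (leftmost) peak `UD`. -/
def deleteFirstPeak : List DyckStep → List DyckStep
  | DyckStep.U :: DyckStep.D :: l => l
  | a :: l => a :: deleteFirstPeak l
  | [] => []

theorem deleteFirstPeak_replicate (a : ℕ) (t : List DyckStep) :
    deleteFirstPeak (List.replicate (a + 1) DyckStep.U ++ DyckStep.D :: t) =
      List.replicate a DyckStep.U ++ t := by
  induction a with
  | zero => rfl
  | succ a ih =>
    have e : List.replicate (a + 1 + 1) DyckStep.U ++ DyckStep.D :: t =
        DyckStep.U :: DyckStep.U :: (List.replicate a DyckStep.U ++ DyckStep.D :: t) := by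
      simp [List.replicate_succ]
    have e' : DyckStep.U :: (List.replicate a DyckStep.U ++ DyckStep.D :: t) =
        List.replicate (a + 1) DyckStep.U ++ DyckStep.D :: t := by
      simp [List.replicate_succ]
    rw [e, deleteFirstPeak, e', ih]
    · simp [List.replicate_succ]
    · simp

theorem exists_replicate_append (l : List DyckStep) :
    (∃ a t, l = List.replicate a DyckStep.U ++ DyckStep.D :: t) ∨
      ∃ a, l = List.replicate a DyckStep.U := by
  induction l with
  | nil => exact Or.inr ⟨0, rfl⟩
  | cons s l ih =>
    cases s with
    | D => exact Or.inl ⟨0, l, rfl⟩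
    | U =>
      rcases ih with ⟨a, t, rfl⟩ | ⟨a, rfl⟩
      · exact Or.inl ⟨a + 1, t, by simp [List.replicate_succ]⟩
      · exact Or.inr ⟨a + 1, by simp [List.replicate_succ]⟩

/-- A nonempty Dyck word starts with a nonempty run of `U`s followed by a `D`. -/
theorem DyckWord.exists_firstPeak (w : DyckWord) (hw : 0 < w.semilength) :
    ∃ a t, w.toList = List.replicate (a + 1) DyckStep.U ++ DyckStep.D :: t := by
  have hU : 0 < w.toList.count DyckStep.U := hw
  have hD := w.count_U_eq_count_D
  rcases exists_replicate_append w.toList with ⟨a, t, h⟩ | ⟨a, h⟩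
  · cases a with
    | zero =>
      have := w.count_D_le_count_U 1
      simp [h] at this
    | succ a => exact ⟨a, t, h⟩
  · rw [h] at hU hD
    simp [List.count_replicate] at hU hD
    omega

/-- A factor starting with `D` of `U^a t` is a factor of `t`. -/
theorem infix_of_infix_replicate_append (x t : List DyckStep) (a : ℕ)
    (h : DyckStep.D :: x <:+: List.replicate a DyckStep.U ++ t) : DyckStep.D :: x <:+: t := by
  induction a with
  | zero => simpa using h
  | succ a ih =>
    rw [List.replicate_succ, List.cons_append, List.infix_cons_iff] at h
    rcases h with h | h
    · simp at h
    · exact ih h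

namespace FibPath

variable {p : ℕ∞} {n : ℕ}

/-- The bonding map `F_{n+1}^p → F_n^p` deleting the first peak. -/
def bond (P : FibPath p (n + 1)) : FibPath p n where
  word :=
    { toList := deleteFirstPeak P.word.toList
      count_U_eq_count_D := by
        obtain ⟨a, t, h⟩ := P.word.exists_firstPeak (by rw [P.semilength_eq]; omega)
        have := P.word.count_U_eq_count_D
        rw [h] at this ⊢
        rw [deleteFirstPeak_replicate]
        simp [List.count_append, List.count_replicate] at this ⊢
        omega
      count_D_le_count_U := by
        intro i
        obtain ⟨a, t, h⟩ := P.word.exists_firstPeak (by rw [P.semilength_eq]; omega)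
        rw [h, deleteFirstPeak_replicate]
        rcases le_total i a with hi | hi
        · simp [List.take_append, List.take_replicate, List.count_replicate,
            Nat.sub_eq_zero_of_le hi]
        · have := P.word.count_D_le_count_U (i + 2)
          rw [h] at this
          have e : i + 2 - (a + 1) = (i - a) + 1 := by omega
          simp [List.take_append, List.take_replicate, List.count_replicate, e,
            List.count_append, hi] at this ⊢
          omega }
  semilength_eq := by
    obtain ⟨a, t, h⟩ := P.word.exists_firstPeak (by rw [P.semilength_eq]; omega)
    have := P.semilength_eq
    rw [DyckWord.semilength, h] at this
    change (deleteFirstPeak P.word.toList).count DyckStep.U = n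
    rw [h, deleteFirstPeak_replicate]
    simp [List.count_append] at this ⊢
    omega
  avoids_DUU := by
    obtain ⟨a, t, h⟩ := P.word.exists_firstPeak (by rw [P.semilength_eq]; omega)
    have := P.avoids_DUU
    rw [h] at this
    change ¬ _ <:+: deleteFirstPeak P.word.toList
    rw [h, deleteFirstPeak_replicate]
    intro hc
    refine this ((infix_of_infix_replicate_append _ _ _ hc).trans ?_)
    exact ⟨List.replicate (a + 1) DyckStep.U ++ [DyckStep.D], [], by simp⟩
  avoids_D := by
    intro k hk
    obtain ⟨a, t, h⟩ := P.word.exists_firstPeak (by rw [P.semilength_eq]; omega)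
    have := P.avoids_D k hk
    rw [h] at this
    change ¬ _ <:+: deleteFirstPeak P.word.toList
    rw [h, deleteFirstPeak_replicate]
    cases k with
    | zero => exact absurd List.nil_infix this
    | succ k =>
      intro hc
      rw [List.replicate_succ] at hc this
      refine this ((infix_of_infix_replicate_append _ _ _ hc).trans ?_)
      exact ⟨List.replicate (a + 1) DyckStep.U ++ [DyckStep.D], [], by simp⟩

end FibPath

/-- The inverse sequence `F_1^p ← F_2^p ← F_3^p ← ⋯` of Hasse diagrams: its `n`-th graph is
`F_{n+1}^p`. -/
def fibGraph (p : ℕ∞) (n : ℕ) : ReflGraph (FibPath p (n + 1)) :=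
  ReflGraph.hasse (FibPath p (n + 1))

/-- The `n`-th bonding map `F_{n+2}^p → F_{n+1}^p`. -/
def fibBond (p : ℕ∞) (n : ℕ) : FibPath p (n + 1 + 1) → FibPath p (n + 1) :=
  FibPath.bond

/-! A path in F_{n+1}^p is determined by its heights h(0), …, h(n), where h(i) counts the up steps
to the right of the i-th down step from the right. Avoiding DUU means that h grows by at most 1 per
step, and avoiding D^{p+1} means h(i) < h(i+p). Together with h(0) = 0 and monotonicity, these
conditions describe exactly the functions that occur (`isHeight_height`, `exists_height_eq`).

In these coordinates the Stanley order is the reversed pointwise order, so pointwise minimum and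
maximum give joins and meets. The Hasse edges are the changes of h by one at a single place
(`covBy_iff_exists_raise`). Deleting the first peak forgets the last value h(n) (`height_bond`),
because counting from the right leaves all other heights alone. A fibre of a bonding map therefore
has at most two points, and these are adjacent; since edges also lift, preimages of connected sets
are connected.

The rest holds for any inverse sequence of finite graphs and monotone epimorphisms that starts with
a single vertex. There is at most one composite between two indices, so amalgamation is automatic.
By compactness the projections of the limit are monotone. Given K, the points agreeing with some
point of K at stage m form a closed connected set, and these sets shrink to K as m grows. For x_k →
x in K, taking for m a stage up to which x_k and x agree yields the sets required by the Kelley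
property. -/

/-! ### Counting up steps before a given down step -/

/-- The number of up steps of `l` before its down step number `i` (counted from `0`); if `l` has at
most `i` down steps, the number of all its up steps. -/
def upsBefore : List DyckStep → ℕ → ℕ
  | [], _ => 0
  | DyckStep.U :: l, i => upsBefore l i + 1
  | DyckStep.D :: _, 0 => 0
  | DyckStep.D :: l, i + 1 => upsBefore l i

theorem upsBefore_mono (l : List DyckStep) : Monotone (upsBefore l) := by
  induction l with
  | nil => intro i j _; simp [upsBefore]
  | cons s l ih =>
    intro i j hij
    cases s with
    | U => simpa [upsBefore] using ih hij
    | D =>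
      cases i with
      | zero => simp [upsBefore]
      | succ i =>
        obtain ⟨j, rfl⟩ : ∃ k, j = k + 1 := ⟨j - 1, by omega⟩
        simpa [upsBefore] using ih (by omega : i ≤ j)

theorem upsBefore_of_count_le (l : List DyckStep) (i : ℕ) (h : l.count DyckStep.D ≤ i) :
    upsBefore l i = l.count DyckStep.U := by
  induction l generalizing i with
  | nil => simp [upsBefore]
  | cons s l ih =>
    cases s with
    | U => simp [upsBefore, ih i (by simpa using h)]
    | D =>
      simp only [List.count_cons_self] at h
      obtain ⟨j, rfl⟩ : ∃ k, i = k + 1 := ⟨i - 1, by omega⟩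
      simp [upsBefore, ih j (by omega)]

theorem upsBefore_append_of_lt (l r : List DyckStep) (i : ℕ) (h : i < l.count DyckStep.D) :
    upsBefore (l ++ r) i = upsBefore l i := by
  induction l generalizing i with
  | nil => simp at h
  | cons s l ih =>
    cases s with
    | U => simp [upsBefore, ih i (by simpa using h)]
    | D =>
      cases i with
      | zero => simp [upsBefore]
      | succ i => simp [upsBefore, ih i (by simpa using h)]

theorem upsBefore_append_count_add (l r : List DyckStep) (i : ℕ) :
    upsBefore (l ++ r) (l.count DyckStep.D + i) = l.count DyckStep.U + upsBefore r i := by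
  induction l with
  | nil => simp
  | cons s l ih =>
    cases s with
    | U => simp [upsBefore, ih]; omega
    | D => simp [upsBefore, Nat.add_right_comm _ 1 i, ih]

theorem count_take_add_upsBefore (l : List DyckStep) (i : ℕ) :
    (l.take (i + upsBefore l i)).count DyckStep.U = upsBefore l i := by
  induction l generalizing i with
  | nil => simp [upsBefore]
  | cons s l ih =>
    cases s with
    | U => simp [upsBefore, ← Nat.add_assoc, ih]
    | D =>
      cases i with
      | zero => simp [upsBefore]
      | succ i => simp [upsBefore, Nat.add_right_comm i 1, ih]

/-- A prefix with at most `i` down steps ends no later than down step number `i`, so the remaining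
up steps before that step only add to the count. -/
theorem count_take_le_upsBefore (l : List DyckStep) (s i : ℕ)
    (h : (l.take s).count DyckStep.D ≤ i) : (l.take s).count DyckStep.U ≤ upsBefore l i := by
  rw [← upsBefore_of_count_le _ _ h]
  conv_rhs => rw [← List.take_append_drop s l]
  obtain ⟨j, rfl⟩ := Nat.exists_eq_add_of_le h
  rw [upsBefore_append_count_add, upsBefore_of_count_le _ _ h]
  omega

theorem upsBefore_le_count_take (l : List DyckStep) (s i : ℕ)
    (h : i < (l.take s).count DyckStep.D) : upsBefore l i ≤ (l.take s).count DyckStep.U := by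
  conv_lhs => rw [← List.take_append_drop s l, upsBefore_append_of_lt _ _ _ h]
  rw [← upsBefore_of_count_le (l.take s) (i + (l.take s).count DyckStep.D) (by omega)]
  exact upsBefore_mono _ (by omega)

theorem count_U_add_count_D (l : List DyckStep) :
    l.count DyckStep.U + l.count DyckStep.D = l.length := by
  induction l with
  | nil => rfl
  | cons s l ih => cases s <;> simp [← ih] <;> omega

/-- Prefixes of one list have at most as many up steps as those of another one iff this holds for
the prefixes ending before the respective down steps of the same number. -/
theorem count_take_le_iff_upsBefore_le (l l' : List DyckStep) (h : l.length = l'.length) :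
    (∀ s, (l.take s).count DyckStep.U ≤ (l'.take s).count DyckStep.U) ↔
      ∀ i, upsBefore l i ≤ upsBefore l' i := by
  constructor
  · intro hs i
    -- This prefix of `l` stops just before down step `i`. The prefix of `l'` of the same length has
    -- at least as many up steps, hence at most `i` down steps.
    have h1 := hs (i + upsBefore l i)
    rw [count_take_add_upsBefore] at h1
    refine h1.trans (count_take_le_upsBefore _ _ _ ?_)
    have h2 := count_U_add_count_D (l'.take (i + upsBefore l i))
    have h3 := List.length_take_le (i + upsBefore l i) l'
    omega
  · intro hi s
    -- At a violating length the prefix of `l'` has more down steps than that of `l`; the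
    -- contradiction comes from the down step whose number is the count of down steps in the latter.
    by_contra! hlt
    have h1 := count_U_add_count_D (l.take s)
    have h2 := count_U_add_count_D (l'.take s)
    rw [List.length_take, h] at h1
    rw [List.length_take] at h2
    have h3 := count_take_le_upsBefore l s _ le_rfl
    have h4 := upsBefore_le_count_take l' s ((l.take s).count DyckStep.D) (by omega)
    have h5 := hi ((l.take s).count DyckStep.D)
    omega

theorem replicate_prefix_of_upsBefore_eq_zero (l : List DyckStep) (k : ℕ)
    (hk : k < l.count DyckStep.D) (h : upsBefore l k = 0) :
    List.replicate (k + 1) DyckStep.D <+: l := by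
  induction l generalizing k with
  | nil => simp at hk
  | cons s l ih =>
    cases s with
    | U => simp [upsBefore] at h
    | D =>
      rw [List.replicate_succ, List.cons_prefix_cons]
      refine ⟨rfl, ?_⟩
      cases k with
      | zero => simp
      | succ k => exact ih k (by simpa using hk) (by simpa [upsBefore] using h)

/-- With no up step between down steps `i` and `i + k`, these and the down steps between them are
consecutive. -/
theorem replicate_infix_of_upsBefore_le (l : List DyckStep) (i k : ℕ)
    (hk : i + k < l.count DyckStep.D) (h : upsBefore l (i + k) ≤ upsBefore l i) :
    List.replicate (k + 1) DyckStep.D <:+: l := by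
  induction l generalizing i with
  | nil => simp at hk
  | cons s l ih =>
    cases s with
    | U =>
      rw [List.infix_cons_iff]
      exact Or.inr (ih i (by simpa using hk) (by simpa [upsBefore] using h))
    | D =>
      cases i with
      | zero =>
        exact (replicate_prefix_of_upsBefore_eq_zero _ _ (by simpa using hk)
          (by simpa [upsBefore] using h)).isInfix
      | succ i =>
        rw [List.infix_cons_iff]
        rw [Nat.add_right_comm] at hk h
        exact Or.inr (ih i (by simpa using hk) (by simpa [upsBefore] using h))

/-! ### Heights of a path -/

namespace FibPath

variable {p : ℕ∞} {n : ℕ}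

/-- The number of up steps of `P` to the right of its down step number `i`, where the down steps
are counted from the right end, beginning with `0`. -/
def height (P : FibPath p n) (i : ℕ) : ℕ :=
  upsBefore P.word.toList.reverse i

theorem count_U (P : FibPath p n) : P.word.toList.count DyckStep.U = n := P.semilength_eq

theorem count_D (P : FibPath p n) : P.word.toList.count DyckStep.D = n := by
  rw [← P.word.count_U_eq_count_D, P.count_U]

theorem length_word (P : FibPath p n) : P.word.toList.length = 2 * n := by
  rw [← P.word.two_mul_semilength_eq_length, P.semilength_eq]

theorem height_mono (P : FibPath p n) : Monotone P.height := upsBefore_mono _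

theorem height_of_le (P : FibPath p n) (i : ℕ) (h : n ≤ i) : P.height i = n := by
  rw [height, upsBefore_of_count_le _ _ (by simpa [P.count_D] using h), List.count_reverse,
    P.count_U]

/-- Up steps in a prefix and in the complementary suffix add up to `n`, so passing to the reversed
words reverses the inequality. -/
theorem le_iff_height_le (P Q : FibPath p n) : P ≤ Q ↔ ∀ i < n, Q.height i ≤ P.height i := by
  have h1 := count_take_le_iff_upsBefore_le Q.word.toList.reverse P.word.toList.reverse
    (by simp [length_word])
  have h2 : (∀ i < n, Q.height i ≤ P.height i) ↔ ∀ i, Q.height i ≤ P.height i := by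
    refine ⟨fun h i => ?_, fun h i _ => h i⟩
    rcases lt_or_ge i n with hi | hi
    · exact h i hi
    · rw [height_of_le _ _ hi, height_of_le _ _ hi]
  rw [h2]
  refine Iff.trans ?_ h1
  have key : ∀ (R : FibPath p n) (l : ℕ), l ≤ 2 * n →
      (R.word.toList.take l).count DyckStep.U +
        (R.word.toList.reverse.take (2 * n - l)).count DyckStep.U = n := by
    intro R l hl
    rw [List.take_reverse, List.count_reverse, R.length_word, Nat.sub_sub_self hl,
      ← List.count_append, List.take_append_drop, R.count_U]
  constructor
  · intro h s
    rcases le_total s (2 * n) with hs | hs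
    · have h3 := key P (2 * n - s) (by omega)
      have h4 := key Q (2 * n - s) (by omega)
      have h5 : _ ≤ _ := h (2 * n - s)
      rw [Nat.sub_sub_self hs] at h3 h4
      omega
    · rw [List.take_of_length_le (by simpa [length_word] using hs),
        List.take_of_length_le (by simpa [length_word] using hs)]
      simp [count_U]
  · intro h l
    rcases le_total l (2 * n) with hl | hl
    · have h3 := key P l hl
      have h4 := key Q l hl
      have h5 := h (2 * n - l)
      omega
    · rw [List.take_of_length_le (by simpa [length_word] using hl),
        List.take_of_length_le (by simpa [length_word] using hl)]
      simp [count_U]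

theorem ext_height {P Q : FibPath p n} (h : ∀ i < n, P.height i = Q.height i) : P = Q :=
  le_antisymm ((le_iff_height_le _ _).2 fun i hi => (h i hi).ge)
    ((le_iff_height_le _ _).2 fun i hi => (h i hi).le)

theorem height_window (P : FibPath p n) (k i : ℕ) (hk : (k : ℕ∞) = p) (hi : i + k < n) :
    P.height i + 1 ≤ P.height (i + k) := by
  by_contra! h
  refine P.avoids_D (k + 1) (by simp [hk]) ?_
  have := replicate_infix_of_upsBefore_le P.word.toList.reverse i k
    (by simpa [P.count_D] using hi) (by simp only [height] at h; omega)
  rw [← List.reverse_infix] at this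
  simpa using this

theorem exists_word_eq (P : FibPath p (n + 1)) :
    ∃ a t, P.word.toList = List.replicate (a + 1) DyckStep.U ++ DyckStep.D :: t ∧
      t.count DyckStep.D = n ∧ a + t.count DyckStep.U = n := by
  obtain ⟨a, t, h⟩ := P.word.exists_firstPeak (by rw [P.semilength_eq]; omega)
  have h1 := P.count_D
  have h2 := P.count_U
  rw [h] at h1 h2
  simp [List.count_append, List.count_replicate] at h1 h2
  exact ⟨a, t, h, h1, by omega⟩

theorem height_eq_of_word_eq (P : FibPath p (n + 1)) (a : ℕ) (t : List DyckStep)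
    (h : P.word.toList = List.replicate a DyckStep.U ++ t) (i : ℕ) (hi : i < t.count DyckStep.D) :
    P.height i = upsBefore t.reverse i := by
  rw [height, h, List.reverse_append, upsBefore_append_of_lt _ _ _ (by simpa using hi)]

theorem word_bond (P : FibPath p (n + 1)) (a : ℕ) (t : List DyckStep)
    (h : P.word.toList = List.replicate (a + 1) DyckStep.U ++ DyckStep.D :: t) :
    P.bond.word.toList = List.replicate a DyckStep.U ++ t := by
  change deleteFirstPeak P.word.toList = _
  rw [h, deleteFirstPeak_replicate]

/-- The first peak contains the leftmost down step, which is the last one in the count from the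
right, and its up step lies left of every other down step. -/
theorem height_bond (P : FibPath p (n + 1 + 1)) (i : ℕ) (hi : i < n + 1) :
    P.bond.height i = P.height i := by
  obtain ⟨a, t, h, hD, -⟩ := P.exists_word_eq
  rw [height_eq_of_word_eq _ _ _ (P.word_bond a t h) _ (by omega),
    height_eq_of_word_eq _ _ _ h _ (by simp; omega), List.reverse_cons,
    upsBefore_append_of_lt _ _ _ (by simpa [hD] using hi)]

theorem upsBefore_reverse_cons_D (t : List DyckStep) :
    upsBefore (DyckStep.D :: t).reverse (t.count DyckStep.D) = t.count DyckStep.U := by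
  have := upsBefore_append_count_add t.reverse [DyckStep.D] 0
  simpa [upsBefore] using this

theorem height_last (P : FibPath p (n + 1)) (a : ℕ) (t : List DyckStep)
    (h : P.word.toList = List.replicate a DyckStep.U ++ DyckStep.D :: t)
    (ht : t.count DyckStep.D = n) : P.height n = t.count DyckStep.U := by
  rw [height_eq_of_word_eq P a _ h n (by simp [ht]), ← ht, upsBefore_reverse_cons_D]

theorem height_succ_last_le (P : FibPath p (n + 1 + 1)) : P.height (n + 1) ≤ P.height n + 1 := by
  obtain ⟨a, t, h, hD, hU⟩ := P.exists_word_eq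
  rw [height_last P _ _ h hD]
  have hDUU := P.avoids_DUU
  rw [h] at hDUU
  rw [height_eq_of_word_eq P _ _ h n (by simp; omega)]
  -- After the first down step the word continues with `UU`, which would complete a factor `DUU`, or
  -- with `UD` or `D`, where the height grows by one or zero.
  rcases t with _ | ⟨_ | _, t⟩
  · simp at hD
  · rcases t with _ | ⟨_ | _, t⟩
    · simp at hD
    · exact absurd ⟨List.replicate (a + 1) DyckStep.U, t, by simp⟩ hDUU
    · simp at hD
      subst hD
      have := upsBefore_append_of_lt (DyckStep.D :: t).reverse [DyckStep.U, DyckStep.D]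
        (t.count DyckStep.D) (by simp)
      rw [upsBefore_reverse_cons_D] at this
      simp at this ⊢
      omega
  · simp at hD
    subst hD
    have := upsBefore_append_of_lt (DyckStep.D :: t).reverse [DyckStep.D]
      (t.count DyckStep.D) (by simp)
    rw [upsBefore_reverse_cons_D] at this
    simp at this ⊢
    omega

theorem height_zero (P : FibPath p (n + 1)) : P.height 0 = 0 := by
  induction n with
  | zero =>
    obtain ⟨a, t, h, hD, hU⟩ := P.exists_word_eq
    rw [height_last P _ _ h hD]
    omega
  | succ n ih => rw [← height_bond P 0 (by omega), ih]

/-- Deleting first peaks until place `i + 1` is the last one reduces this to `height_succ_last_le`.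
-/
theorem height_succ_le (P : FibPath p (n + 1)) (i : ℕ) (hi : i < n) :
    P.height (i + 1) ≤ P.height i + 1 := by
  induction n with
  | zero => omega
  | succ n ih =>
    rcases Nat.lt_or_ge i n with h | h
    · rw [← height_bond P i (by omega), ← height_bond P (i + 1) (by omega)]
      exact ih _ h
    · obtain rfl : i = n := by omega
      exact P.height_succ_last_le

end FibPath

/-! ### Lifting paths and realizing height functions -/

namespace FibPath

variable {p : ℕ∞} {n : ℕ}

/-- A word with the defining properties of a path that becomes the word of `P` when its first peak
is deleted is the word of a path over `P`. -/
theorem exists_of_word (P : FibPath p (n + 1)) (w : List DyckStep)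
    (hU : w.count DyckStep.U = n + 1 + 1) (hD : w.count DyckStep.D = n + 1 + 1)
    (hpos : ∀ i, (w.take (i + 2)).count DyckStep.D ≤ (w.take (i + 2)).count DyckStep.U)
    (hpos' : (w.take 1).count DyckStep.D ≤ (w.take 1).count DyckStep.U)
    (hDUU : ¬ [DyckStep.D, DyckStep.U, DyckStep.U] <:+: w)
    (hrep : ∀ k : ℕ, (k : ℕ∞) = p + 1 → ¬ List.replicate k DyckStep.D <:+: w)
    (hbond : deleteFirstPeak w = P.word.toList) :
    ∃ P' : FibPath p (n + 1 + 1), P'.word.toList = w ∧ P'.bond = P := by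
  refine ⟨⟨⟨w, by rw [hU, hD], ?_⟩, hU, hDUU, hrep⟩, rfl, ?_⟩
  · rintro (_ | _ | i)
    · simp
    · exact hpos'
    · exact hpos i
  · exact FibPath.ext (DyckWord.ext hbond)

/-- Replace the first peak `UD` by `UDUD`. The new down step is isolated and is followed by a single
up step, so no forbidden factor arises and no condition on `P` is needed. -/
theorem exists_bond_eq_height_add_one (hp : 1 ≤ p) (P : FibPath p (n + 1)) :
    ∃ P' : FibPath p (n + 1 + 1), P'.bond = P ∧ P'.height (n + 1) = P.height n + 1 := by
  obtain ⟨a, t, h, hD, hU⟩ := P.exists_word_eq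
  have hpre := P.word.count_D_le_count_U
  rw [h] at hpre
  refine Exists.elim (exists_of_word P
    (List.replicate (a + 1) DyckStep.U ++ DyckStep.D :: DyckStep.U :: DyckStep.D :: t)
    (by simp; omega) (by simp [List.count_replicate]; omega) (fun i => ?_) ?_ (fun hc => ?_)
    (fun k hk hc => ?_)
    (by rw [deleteFirstPeak_replicate, h]; simp [List.replicate_succ'])) (fun P' hP' => ?_)
  · rcases le_or_gt (i + 2) (a + 1) with hi | hi
    · simp [List.take_append, List.take_replicate, List.count_replicate,
        Nat.sub_eq_zero_of_le hi]
    · obtain ⟨j, rfl⟩ : ∃ j, i = a + j := ⟨i - a, by omega⟩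
      have h1 := hpre (a + j)
      have e : a + j + 2 - (a + 1) = j + 1 := by omega
      rcases j with _ | j
      · simp [List.take_append, List.take_replicate, List.count_replicate, e]
      · have e' : a + (j + 1) - (a + 1) = j := by omega
        rcases j with _ | j
        · simp [List.take_append, List.take_replicate, List.count_replicate, e]
        · simp [List.take_append, List.take_replicate, List.count_replicate, e, e'] at h1 ⊢
          omega
  · simp [List.replicate_succ]
  · have hDUU := P.avoids_DUU
    rw [h] at hDUU
    have := infix_of_infix_replicate_append _ _ _ hc
    simp [List.infix_cons_iff] at this
    refine hDUU (List.IsInfix.trans ?_ (List.suffix_append _ _).isInfix)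
    simpa [List.infix_cons_iff] using this
  · obtain ⟨m, rfl⟩ : ∃ m, k = m + 2 := by
      have : ((2 : ℕ) : ℕ∞) ≤ k := by
        rw [hk, show ((2 : ℕ) : ℕ∞) = 1 + 1 by norm_num]
        gcongr
      exact ⟨k - 2, by have := Nat.cast_le.1 this; omega⟩
    have hrep := P.avoids_D _ hk
    rw [h] at hrep
    rw [List.replicate_succ (a := DyckStep.D), List.replicate_succ (a := DyckStep.D)] at hc hrep
    have := infix_of_infix_replicate_append _ _ _ hc
    refine hrep (List.IsInfix.trans ?_ (List.suffix_append _ _).isInfix)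
    rw [List.infix_cons_iff, List.infix_cons_iff] at this
    simpa using this
  · obtain ⟨hw, hb⟩ := hP'
    refine ⟨P', hb, ?_⟩
    rw [height_last P' _ _ hw (by simp [hD]), height_last P _ _ h hD]
    simp

/-- Replace the first peak `UD` by `UUDD`. This lengthens the first run of down steps, and `hwin`
says that the run stays short enough. -/
theorem exists_bond_eq_height_eq (hp : 1 ≤ p) (P : FibPath p (n + 1))
    (hwin : ∀ k i : ℕ, (k : ℕ∞) = p → i + k = n + 1 → P.height i + 1 ≤ P.height n) :
    ∃ P' : FibPath p (n + 1 + 1), P'.bond = P ∧ P'.height (n + 1) = P.height n := by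
  obtain ⟨a, t, h, hD, hU⟩ := P.exists_word_eq
  have hpre := P.word.count_D_le_count_U
  rw [h] at hpre
  refine Exists.elim (exists_of_word P
    (List.replicate (a + 1 + 1) DyckStep.U ++ DyckStep.D :: DyckStep.D :: t)
    (by simp; omega) (by simp [List.count_replicate]; omega) (fun i => ?_) ?_ (fun hc => ?_)
    (fun k hk hc => ?_)
    (by rw [deleteFirstPeak_replicate, h])) (fun P' hP' => ?_)
  · rcases le_or_gt (i + 2) (a + 1 + 1) with hi | hi
    · simp [List.take_append, List.take_replicate, List.count_replicate,
        Nat.sub_eq_zero_of_le hi]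
    · obtain ⟨j, rfl⟩ : ∃ j, i = a + 1 + j := ⟨i - (a + 1), by omega⟩
      have h1 := hpre (a + 1 + j)
      have e : a + 1 + j + 2 - (a + 1 + 1) = j + 1 := by omega
      have e' : a + 1 + j - (a + 1) = j := by omega
      rcases j with _ | j
      · simp [List.take_append, List.take_replicate, List.count_replicate]
      · simp [List.take_append, List.take_replicate, List.count_replicate, e, e'] at h1 ⊢
        omega
  · simp [List.replicate_succ]
  · have hDUU := P.avoids_DUU
    rw [h] at hDUU
    have := infix_of_infix_replicate_append _ _ _ hc
    rw [List.infix_cons_iff] at this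
    refine hDUU (List.IsInfix.trans ?_ (List.suffix_append _ _).isInfix)
    simpa using this
  · obtain ⟨m, rfl⟩ : ∃ m, k = m + 2 := by
      have : ((2 : ℕ) : ℕ∞) ≤ k := by
        rw [hk, show ((2 : ℕ) : ℕ∞) = 1 + 1 by norm_num]
        gcongr
      exact ⟨k - 2, by have := Nat.cast_le.1 this; omega⟩
    have hrep := P.avoids_D _ hk
    rw [h] at hrep
    rw [List.replicate_succ] at hc hrep
    have := infix_of_infix_replicate_append _ _ _ hc
    rw [List.infix_cons_iff] at this
    rcases this with hc | hc
    -- A new forbidden factor would start at the added down step. Then the word of `P` has `m + 1 =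
    -- p` consecutive down steps from its first one on, and the height at the last of them equals
    -- `P.height n`, against `hwin`.
    · rw [List.replicate_succ, List.cons_prefix_cons, List.cons_prefix_cons] at hc
      obtain ⟨s, rfl⟩ := hc.2.2
      have hm : ((m + 1 : ℕ) : ℕ∞) = p := by
        have : ((m + 1 : ℕ) : ℕ∞) + 1 = p + 1 := by rw [← hk]; norm_cast
        exact (ENat.add_left_injective_of_ne_top (n := 1) (by simp)) this
      simp [List.count_append] at hD
      have h1 := hwin (m + 1) (s.count DyckStep.D) hm (by omega)
      rw [height_last P _ _ h (by simp [hD]), height_eq_of_word_eq P _ _ h _ (by simp)]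
        at h1
      have h2 := upsBefore_append_count_add s.reverse (List.replicate (m + 1) DyckStep.D) 0
      simp [List.replicate_succ, upsBefore] at h2
      simp [List.count_append, List.count_replicate] at h1
      have h3 : List.replicate m DyckStep.D ++ [DyckStep.D] =
        DyckStep.D :: List.replicate m DyckStep.D := by
          rw [← List.replicate_succ', List.replicate_succ]
      simp [h3, h2] at h1
    · exact hrep (hc.trans (List.suffix_append _ _).isInfix)
  · obtain ⟨hw, hb⟩ := hP'
    refine ⟨P', hb, ?_⟩
    rw [height_last P' _ _ hw (by simp [hD]), height_last P _ _ h hD]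
    simp

theorem nonempty_one (hp : 1 ≤ p) : Nonempty (FibPath p 1) := by
  refine ⟨⟨⟨[DyckStep.U, DyckStep.D], by decide, ?_⟩, rfl, ?_, fun k hk hc => ?_⟩⟩
  · rintro (_ | _ | i) <;> simp
  · decide
  · have h1 := hc.sublist.count_le DyckStep.D
    have h2 : ((2 : ℕ) : ℕ∞) ≤ k := by
      rw [hk, show ((2 : ℕ) : ℕ∞) = 1 + 1 by norm_num]
      gcongr
    have h3 := Nat.cast_le.1 h2
    simp at h1
    omega

/-- The functions on `{0, …, n}` that are heights of paths in `F_{n+1}^p`. -/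
structure IsHeight (p : ℕ∞) (n : ℕ) (h : ℕ → ℕ) : Prop where
  zero : h 0 = 0
  le_succ : ∀ i < n, h i ≤ h (i + 1)
  succ_le : ∀ i < n, h (i + 1) ≤ h i + 1
  window : ∀ k i : ℕ, (k : ℕ∞) = p → i + k ≤ n → h i + 1 ≤ h (i + k)

theorem isHeight_height (P : FibPath p (n + 1)) : IsHeight p n P.height where
  zero := P.height_zero
  le_succ _ _ := P.height_mono (Nat.le_succ _)
  succ_le := P.height_succ_le
  window k i hk hi := P.height_window k i hk (by omega)

/-- Values are added one at a time: `h (n + 1)` is `h n` or `h n + 1`, and the two lifting lemmas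
realize both choices. -/
theorem exists_height_eq (hp : 1 ≤ p) (h : ℕ → ℕ) (hh : IsHeight p n h) :
    ∃ P : FibPath p (n + 1), ∀ i ≤ n, P.height i = h i := by
  induction n with
  | zero =>
    obtain ⟨P⟩ := nonempty_one hp
    refine ⟨P, fun i hi => ?_⟩
    obtain rfl : i = 0 := by omega
    rw [height_zero, hh.zero]
  | succ n ih =>
    obtain ⟨P, hP⟩ := ih ⟨hh.zero, fun i hi => hh.le_succ i (by omega),
      fun i hi => hh.succ_le i (by omega), fun k i hk hi => hh.window k i hk (by omega)⟩
    have h1 := hh.le_succ n (by omega)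
    have h2 := hh.succ_le n (by omega)
    suffices ∃ P' : FibPath p (n + 1 + 1), P'.bond = P ∧ P'.height (n + 1) = h (n + 1) by
      obtain ⟨P', rfl, hP'⟩ := this
      refine ⟨P', fun i hi => ?_⟩
      rcases hi.lt_or_eq with hi | rfl
      · rw [← hP i (by omega), height_bond _ _ hi]
      · exact hP'
    rcases h2.lt_or_eq with h3 | h3
    · obtain ⟨P', hb, hP'⟩ := exists_bond_eq_height_eq hp P fun k i hk hi => by
        have hk0 : k ≠ 0 := by rintro rfl; simp [← hk] at hp
        have := hh.window k i hk (by omega)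
        rw [hi] at this
        rw [hP i (by omega), hP n le_rfl]
        omega
      exact ⟨P', hb, by rw [hP', hP n le_rfl]; omega⟩
    · obtain ⟨P', hb, hP'⟩ := exists_bond_eq_height_add_one hp P
      exact ⟨P', hb, by rw [hP', hP n le_rfl, h3]⟩

/-- Apart from the value at `0`, each condition compares two places up to a constant, and such
inequalities survive pointwise minima and maxima. -/
theorem isHeight_min {f g : ℕ → ℕ} (hf : IsHeight p n f) (hg : IsHeight p n g) :
    IsHeight p n fun i => min (f i) (g i) where
  zero := by simp [hf.zero]
  le_succ i hi := by have := hf.le_succ i hi; have := hg.le_succ i hi; omega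
  succ_le i hi := by have := hf.succ_le i hi; have := hg.succ_le i hi; omega
  window k i hk hi := by have := hf.window k i hk hi; have := hg.window k i hk hi; omega

theorem isHeight_max {f g : ℕ → ℕ} (hf : IsHeight p n f) (hg : IsHeight p n g) :
    IsHeight p n fun i => max (f i) (g i) where
  zero := by simp [hf.zero, hg.zero]
  le_succ i hi := by have := hf.le_succ i hi; have := hg.le_succ i hi; omega
  succ_le i hi := by have := hf.succ_le i hi; have := hg.succ_le i hi; omega
  window k i hk hi := by have := hf.window k i hk hi; have := hg.window k i hk hi; omega

theorem exists_isLUB (hp : 1 ≤ p) (P Q : FibPath p (n + 1)) : ∃ J, IsLUB {P, Q} J := by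
  obtain ⟨J, hJ⟩ := exists_height_eq hp _ (isHeight_min P.isHeight_height Q.isHeight_height)
  refine ⟨J, ?_, fun R hR => ?_⟩
  · rintro R (rfl | rfl) <;>
    · rw [le_iff_height_le]
      intro i hi
      rw [hJ i (by omega)]
      omega
  · have h1 := (le_iff_height_le _ _).1 (hR (Set.mem_insert P {Q}))
    have h2 := (le_iff_height_le _ _).1 (hR (Set.mem_insert_of_mem P (Set.mem_singleton Q)))
    rw [le_iff_height_le]
    intro i hi
    rw [hJ i (by omega)]
    exact le_min (h1 i hi) (h2 i hi)

theorem exists_isGLB (hp : 1 ≤ p) (P Q : FibPath p (n + 1)) : ∃ M, IsGLB {P, Q} M := by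
  obtain ⟨M, hM⟩ := exists_height_eq hp _ (isHeight_max P.isHeight_height Q.isHeight_height)
  refine ⟨M, ?_, fun R hR => ?_⟩
  · rintro R (rfl | rfl) <;>
    · rw [le_iff_height_le]
      intro i hi
      rw [hM i (by omega)]
      omega
  · have h1 := (le_iff_height_le _ _).1 (hR (Set.mem_insert P {Q}))
    have h2 := (le_iff_height_le _ _).1 (hR (Set.mem_insert_of_mem P (Set.mem_singleton Q)))
    rw [le_iff_height_le]
    intro i hi
    rw [hM i (by omega)]
    exact max_le (h1 i hi) (h2 i hi)

/-! ### Covering relations -/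

/-- `P` arises from `Q` by raising the height at `i` by one. -/
def Raise (P Q : FibPath p (n + 1)) (i : ℕ) : Prop :=
  i ≤ n ∧ P.height i = Q.height i + 1 ∧ ∀ j ≤ n, j ≠ i → P.height j = Q.height j

theorem Raise.covBy {P Q : FibPath p (n + 1)} {i : ℕ} (h : Raise P Q i) : P ⋖ Q := by
  obtain ⟨hi, h1, h2⟩ := h
  refine ⟨lt_of_le_of_ne ?_ ?_, fun R hPR hRQ => ?_⟩
  · rw [le_iff_height_le]
    intro j hj
    rcases eq_or_ne j i with rfl | hji
    · omega
    · rw [h2 j (by omega) hji]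
  · rintro rfl
    omega
  · have h3 := (le_iff_height_le _ _).1 hPR.le
    have h4 := (le_iff_height_le _ _).1 hRQ.le
    by_cases hR : R.height i = P.height i
    · refine hPR.ne (ext_height fun j hj => ?_)
      rcases eq_or_ne j i with rfl | hji
      · exact hR.symm
      · have := h3 j hj; have := h4 j hj; have := h2 j (by omega) hji; omega
    · refine hRQ.ne (ext_height fun j hj => ?_)
      have := h3 j hj; have := h4 j hj
      rcases eq_or_ne j i with rfl | hji
      · omega
      · have := h2 j (by omega) hji; omega

/-- A path strictly below `Q` stays below `Q` after a suitable raise of `Q` at one place. -/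
theorem exists_raise (hp : 1 ≤ p) {P Q : FibPath p (n + 1)} (h : P < Q) :
    ∃ R i, Raise R Q i ∧ P ≤ R := by
  have hle := (le_iff_height_le _ _).1 h.le
  have hP := P.isHeight_height
  have hQ := Q.isHeight_height
  obtain ⟨i₀, hi₀, hlt₀⟩ : ∃ i, i ≤ n ∧ Q.height i < P.height i := by
    by_contra! hc
    exact h.ne (ext_height fun i hi => le_antisymm (hc i (by omega)) (hle i hi))
  -- the last place where the heights differ
  obtain ⟨m, hm, hmlt, hmmax⟩ : ∃ m ≤ n, Q.height m < P.height m ∧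
      ∀ j ≤ n, m < j → Q.height j = P.height j := by
    set S := (Finset.range (n + 1)).filter fun i => Q.height i < P.height i
    have hS : S.Nonempty := ⟨i₀, by simp [S]; omega⟩
    have h1 := S.max'_mem hS
    rw [Finset.mem_filter, Finset.mem_range] at h1
    refine ⟨S.max' hS, by omega, h1.2, fun j hj hmj => ?_⟩
    by_contra hne
    have := S.le_max' j (by simp [S]; have := hle j (by omega); omega)
    omega
  -- the beginning of the run of increments of `Q` that ends there
  obtain ⟨d, hd, hdrun, hdflat⟩ : ∃ d ≤ m, (∀ e ≤ d, Q.height (m - e) + e = Q.height m) ∧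
      (d < m → Q.height (m - d - 1) = Q.height (m - d)) := by
    classical
    by_cases hex : ∃ d, d < m ∧ Q.height (m - d - 1) = Q.height (m - d)
    · have hspec := Nat.find_spec hex
      refine ⟨Nat.find hex, hspec.1.le, fun e he => ?_, fun _ => hspec.2⟩
      induction e with
      | zero => simp
      | succ e ih =>
        have h1 := ih (by omega)
        have h2 := Nat.find_min hex (by omega : e < Nat.find hex)
        have h3 := hQ.le_succ (m - e - 1) (by omega)
        have h4 := hQ.succ_le (m - e - 1) (by omega)
        rw [show m - e - 1 + 1 = m - e by omega] at h3 h4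
        rw [show m - (e + 1) = m - e - 1 by omega]
        omega
    · push Not at hex
      refine ⟨m, le_rfl, fun e he => ?_, fun h => by omega⟩
      induction e with
      | zero => simp
      | succ e ih =>
        have h1 := ih (by omega)
        have h2 := hex e (by omega)
        have h3 := hQ.le_succ (m - e - 1) (by omega)
        have h4 := hQ.succ_le (m - e - 1) (by omega)
        rw [show m - e - 1 + 1 = m - e by omega] at h3 h4
        rw [show m - (e + 1) = m - e - 1 by omega]
        omega
  -- Going back from `m`, `P` falls by at most one per step while `Q` falls by exactly one along the
  -- run, so `P` still exceeds `Q` at the start of the run.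
  have hPm : ∀ e ≤ m, P.height m ≤ P.height (m - e) + e := by
    intro e he
    induction e with
    | zero => simp
    | succ e ih =>
      have h1 := ih (by omega)
      have h4 := hP.succ_le (m - e - 1) (by omega)
      rw [show m - e - 1 + 1 = m - e by omega] at h4
      rw [show m - (e + 1) = m - e - 1 by omega]
      omega
  obtain ⟨i, rfl⟩ : ∃ i, m = i + d := ⟨m - d, by omega⟩
  simp only [Nat.add_sub_cancel] at hdflat
  have hrun : ∀ e ≤ d, Q.height (i + e) = Q.height i + e := by
    intro e he
    have h1 := hdrun (d - e) (by omega)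
    have h2 := hdrun d le_rfl
    rw [show i + d - (d - e) = i + e by omega] at h1
    rw [Nat.add_sub_cancel] at h2
    omega
  have hi : Q.height i < P.height i := by
    have h1 := hPm d hd
    have h2 := hrun d le_rfl
    rw [Nat.add_sub_cancel] at h1
    omega
  have hi0 : 0 < i := by
    rcases Nat.eq_zero_or_pos i with rfl | h0
    · rw [hP.zero] at hi; omega
    · exact h0
  have hflat := hdflat (by omega)
  have hnext : i < n → Q.height (i + 1) = Q.height i + 1 := by
    intro hin
    rcases Nat.eq_zero_or_pos d with rfl | h0
    · have h1 := hmmax (i + 1) (by omega) (by omega)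
      have h2 := hP.le_succ i hin
      have h3 := hQ.succ_le i hin
      omega
    · exact hrun 1 h0
  -- `Q` is flat just before `i` and rises just after it (if `i < n`), so adding one at `i` keeps
  -- all increments in {0, 1}.
  obtain ⟨R, hR⟩ := exists_height_eq hp (fun j => if j = i then Q.height j + 1 else Q.height j)
    (n := n) (by
      refine ⟨by simp [hi0.ne, hQ.zero], fun j hj => ?_, fun j hj => ?_, fun k j hk hj => ?_⟩
      · have h1 := hQ.le_succ j hj
        by_cases hji : j = i
        · subst hji
          simp [hnext hj]
        · split_ifs <;> omega
      · have h1 := hQ.succ_le j hj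
        by_cases hji : j + 1 = i
        · subst hji
          simp at hflat
          simp [hflat]
        · split_ifs <;> omega
      · have h1 := hQ.window k j hk hj
        have h2 := hP.window k j hk hj
        by_cases hji : j = i
        · subst hji
          have hk0 : k ≠ 0 := by rintro rfl; simp [← hk] at hp
          rw [if_pos rfl, if_neg (by omega)]
          -- Within the run `Q` gains `k`, which suffices for `k ≥ 2`; for `k = 1 = p` the flat step
          -- before `i` is impossible. Beyond the run `Q` agrees with `P`, whose own window
          -- condition gives the bound.
          by_cases hkd : k ≤ d
          · have h3 := hrun k hkd
            rcases Nat.lt_or_ge 1 k with hk1 | hk1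
            · omega
            · obtain rfl : k = 1 := by omega
              have h4 := hQ.window 1 (j - 1) hk (by omega)
              rw [Nat.sub_add_cancel hi0] at h4
              omega
          · have h3 := hmmax (j + k) hj (by omega)
            omega
        · rw [if_neg hji]
          split_ifs <;> omega)
  refine ⟨R, i, ⟨by omega, by rw [hR i (by omega), if_pos rfl], fun j hj hji => ?_⟩, ?_⟩
  · rw [hR j hj, if_neg hji]
  · rw [le_iff_height_le]
    intro j hj
    rw [hR j (by omega)]
    split_ifs with hji
    · subst hji; exact hi
    · exact hle j hj

theorem covBy_iff_exists_raise (hp : 1 ≤ p) (P Q : FibPath p (n + 1)) :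
    P ⋖ Q ↔ ∃ i, Raise P Q i := by
  refine ⟨fun h => ?_, fun ⟨i, h⟩ => h.covBy⟩
  obtain ⟨R, i, hR, hPR⟩ := exists_raise hp h.lt
  rcases hPR.eq_or_lt with rfl | hlt
  · exact ⟨i, hR⟩
  · exact absurd hR.covBy.lt (h.2 hlt)

end FibPath

/-! ### Composition and a criterion for monotonicity -/

namespace ReflGraph

variable {V W X : Type*}

theorem IsEpimorphism.id (G : ReflGraph V) : G.IsEpimorphism G id where
  map_edge _ _ h := h
  surj_vertex c := ⟨c, rfl⟩
  surj_edge c d h := ⟨c, d, h, rfl, rfl⟩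

theorem IsEpimorphism.comp {G : ReflGraph V} {H : ReflGraph W} {K : ReflGraph X} {g : W → X}
    {f : V → W} (hg : H.IsEpimorphism K g) (hf : G.IsEpimorphism H f) :
    G.IsEpimorphism K (g ∘ f) where
  map_edge _ _ h := hg.map_edge _ _ (hf.map_edge _ _ h)
  surj_vertex c := by
    obtain ⟨b, rfl⟩ := hg.surj_vertex c
    obtain ⟨a, rfl⟩ := hf.surj_vertex b
    exact ⟨a, rfl⟩
  surj_edge c d h := by
    obtain ⟨b, b', hb, rfl, rfl⟩ := hg.surj_edge c d h
    obtain ⟨a, a', ha, rfl, rfl⟩ := hf.surj_edge b b' hb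
    exact ⟨a, a', ha, rfl, rfl⟩

theorem IsMonotoneEpi.id [TopologicalSpace V] (G : ReflGraph V) : G.IsMonotoneEpi G id where
  continuous := continuous_id
  epi := .id G
  monotone _ _ h := h

theorem IsMonotoneEpi.comp [TopologicalSpace V] [TopologicalSpace W] [TopologicalSpace X]
    {G : ReflGraph V} {H : ReflGraph W} {K : ReflGraph X} {g : W → X} {f : V → W}
    (hg : H.IsMonotoneEpi K g) (hf : G.IsMonotoneEpi H f) : G.IsMonotoneEpi K (g ∘ f) where
  continuous := hg.continuous.comp hf.continuous
  epi := hg.epi.comp hf.epi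
  monotone Q hQ h := hf.monotone _ (hQ.preimage hg.continuous) (hg.monotone Q hQ h)

/-- An epimorphism of discrete graphs any two vertices in a common fibre of which are adjacent is
monotone. -/
theorem IsEpimorphism.isMonotoneEpi [TopologicalSpace V] [DiscreteTopology V] [TopologicalSpace W]
    [DiscreteTopology W] {G : ReflGraph V} {H : ReflGraph W} {f : V → W}
    (hf : G.IsEpimorphism H f) (hfib : ∀ a b, f a = f b → G.Edge a b) :
    G.IsMonotoneEpi H f where
  continuous := continuous_of_discreteTopology
  epi := hf
  monotone Q _ hQ := by
    rintro ⟨A, B, -, -, hAB, ⟨a, ha⟩, ⟨b, hb⟩, hdisj, hedge⟩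
    -- Since fibres are cliques, none meets both halves. Hence the images are disjoint, and a lift
    -- of an edge between them again runs from one half to the other.
    refine hQ ⟨f '' (f ⁻¹' Q ∩ A), f '' (f ⁻¹' Q ∩ B), isClosed_discrete _, isClosed_discrete _,
      fun c hc => ?_, ⟨f a, ha.1, a, ha, rfl⟩, ⟨f b, hb.1, b, hb, rfl⟩, ?_, ?_⟩
    · obtain ⟨x, rfl⟩ := hf.surj_vertex c
      exact (hAB hc).imp (fun h => ⟨x, ⟨hc, h⟩, rfl⟩) (fun h => ⟨x, ⟨hc, h⟩, rfl⟩)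
    · rw [Set.disjoint_left]
      rintro c ⟨-, x, hx, rfl⟩ ⟨-, y, hy, hxy⟩
      exact hedge x hx y hy (hfib x y hxy.symm)
    · rintro c ⟨-, x, hx, rfl⟩ d ⟨-, y, hy, rfl⟩ he
      obtain ⟨x', y', he', hx', hy'⟩ := hf.surj_edge _ _ he
      have hxQ : x' ∈ f ⁻¹' Q := by rw [Set.mem_preimage, hx']; exact hx.1
      have hyQ : y' ∈ f ⁻¹' Q := by rw [Set.mem_preimage, hy']; exact hy.1
      have hxA : x' ∈ A := (hAB hxQ).resolve_right fun h =>
        hedge x hx x' ⟨hxQ, h⟩ (hfib _ _ hx'.symm)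
      have hyB : y' ∈ B := (hAB hyQ).resolve_left fun h =>
        hedge y' ⟨hyQ, h⟩ y hy (hfib _ _ hy')
      exact hedge x' ⟨hxQ, hxA⟩ y' ⟨hyQ, hyB⟩ he'

end ReflGraph

/-! ### Composites of bonding maps -/

namespace InvSeq

variable {V : ℕ → Type*} {α : ∀ n, V (n + 1) → V n}

theorem IsComposite.le {m n : ℕ} {f : V m → V n} (hf : IsComposite α m n f) : n ≤ m := by
  induction hf with
  | id n => exact le_rfl
  | comp m n f _ ih => omega

/-- Each bonding map lowers the index by exactly one, so the two indices fix the composite. This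
makes every amalgamation square commute. -/
theorem IsComposite.unique {m n : ℕ} {f g : V m → V n} (hf : IsComposite α m n f)
    (hg : IsComposite α m n g) : f = g := by
  induction hf with
  | id n =>
    cases hg with
    | id => rfl
    | comp m _ g hg => exact absurd hg.le (by omega)
  | comp m n f hf ih =>
    cases hg with
    | id => exact absurd hf.le (by omega)
    | comp _ _ g hg => rw [ih hg]

theorem IsComposite.trans {i j k : ℕ} {f : V i → V j} {g : V j → V k} (hf : IsComposite α i j f)
    (hg : IsComposite α j k g) : IsComposite α i k (g ∘ f) := by
  induction hf with
  | id n => exact hg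
  | comp m n f _ ih => exact .comp m k _ (ih hg)

theorem IsComposite.bond (n : ℕ) : IsComposite α (n + 1) n (α n) := .comp n n _ (.id n)

theorem exists_isComposite (α : ∀ n, V (n + 1) → V n) {m n : ℕ} (h : n ≤ m) :
    ∃ f : V m → V n, IsComposite α m n f := by
  induction m, h using Nat.le_induction with
  | base => exact ⟨_, .id n⟩
  | succ m _ ih =>
    obtain ⟨f, hf⟩ := ih
    exact ⟨_, hf.comp⟩

theorem IsComposite.isEpimorphism {G : ∀ n, ReflGraph (V n)}
    (hα : ∀ n, (G (n + 1)).IsEpimorphism (G n) (α n)) {m n : ℕ} {f : V m → V n}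
    (hf : IsComposite α m n f) : (G m).IsEpimorphism (G n) f := by
  induction hf with
  | id n => exact .id _
  | comp m n f _ ih => exact ih.comp (hα m)

theorem IsComposite.isMonotoneEpi [∀ n, TopologicalSpace (V n)] {G : ∀ n, ReflGraph (V n)}
    (hα : ∀ n, (G (n + 1)).IsMonotoneEpi (G n) (α n)) {m n : ℕ} {f : V m → V n}
    (hf : IsComposite α m n f) : (G m).IsMonotoneEpi (G n) f := by
  induction hf with
  | id n => exact .id _
  | comp m n f _ ih => exact ih.comp (hα m)

/-- The graphs of an inverse sequence of finite graphs and epimorphisms form a projective Fraïssé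
family. -/
theorem isProjectiveFraisse [∀ n, Finite (V n)] {G : ∀ n, ReflGraph (V n)}
    (hα : ∀ n, (G (n + 1)).IsEpimorphism (G n) (α n)) :
    ReflGraph.IsProjectiveFraisse G (Composites α) where
  nonempty := ⟨0⟩
  finite := inferInstance
  epi _ _ _ hf := IsComposite.isEpimorphism hα hf
  countable S _ := S.to_countable
  id_mem := .id
  comp_mem _ _ _ _ hf _ hg := hf.trans hg
  joint b c := ⟨max b c, exists_isComposite α (le_max_left b c),
    exists_isComposite α (le_max_right b c)⟩
  amalgamation a b c f hf g hg := by
    obtain ⟨f₀, hf₀⟩ := exists_isComposite α (le_max_left b c)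
    obtain ⟨g₀, hg₀⟩ := exists_isComposite α (le_max_right b c)
    exact ⟨max b c, f₀, hf₀, g₀, hg₀, (hf₀.trans hf).unique (hg₀.trans hg)⟩

end InvSeq

/-! ### The bonding maps are monotone epimorphisms -/

namespace FibPath

variable {p : ℕ∞} {n : ℕ}

instance : DiscreteTopology (FibPath p n) := ⟨rfl⟩

instance : Finite (FibPath p n) :=
  Finite.of_injective (fun P (i : Fin n) => (⟨P.height i, by
    have := P.height_mono i.2.le
    rw [P.height_of_le n le_rfl] at this
    omega⟩ : Fin (n + 1))) fun P Q h =>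
      ext_height fun i hi => by simpa using congrFun h ⟨i, hi⟩

/-- Only the last heights can differ, and each is the common previous height or one more. -/
theorem eq_or_raise_of_bond_eq {P Q : FibPath p (n + 1 + 1)} (h : P.bond = Q.bond) :
    P = Q ∨ Raise P Q (n + 1) ∨ Raise Q P (n + 1) := by
  have key : ∀ i < n + 1, P.height i = Q.height i := fun i hi => by
    rw [← height_bond P i hi, ← height_bond Q i hi, h]
  have h1 := key n (by omega)
  have h2 := P.height_mono (Nat.le_succ n)
  have h3 := Q.height_mono (Nat.le_succ n)
  have h4 := P.height_succ_last_le
  have h5 := Q.height_succ_last_le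
  simp only [Nat.succ_eq_add_one] at h2 h3
  rcases lt_trichotomy (P.height (n + 1)) (Q.height (n + 1)) with h6 | h6 | h6
  · exact Or.inr (Or.inr ⟨le_rfl, by omega, fun j hj hne => (key j (by omega)).symm⟩)
  · refine Or.inl (ext_height fun i hi => ?_)
    rcases Nat.lt_or_ge i (n + 1) with h7 | h7
    · exact key i h7
    · obtain rfl : i = n + 1 := by omega
      exact h6
  · exact Or.inr (Or.inl ⟨le_rfl, by omega, fun j hj hne => key j (by omega)⟩)

theorem Raise.bond {P Q : FibPath p (n + 1 + 1)} {i : ℕ} (h : Raise P Q i) :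
    P.bond = Q.bond ∨ Raise P.bond Q.bond i := by
  obtain ⟨hi, h1, h2⟩ := h
  rcases hi.eq_or_lt with rfl | hi
  · refine Or.inl (ext_height fun j hj => ?_)
    rw [height_bond _ _ hj, height_bond _ _ hj, h2 j (by omega) (by omega)]
  · refine Or.inr ⟨by omega, ?_, fun j hj hji => ?_⟩
    · rw [height_bond _ _ hi, height_bond _ _ hi, h1]
    · rw [height_bond _ _ (by omega), height_bond _ _ (by omega), h2 j (by omega) hji]

/-- Extend `D` by an increment and `C` so that the new last heights agree; the lifts then differ
only at `i`. For `i = n` the extension of `C` has to be flat, otherwise it is an increment too. -/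
theorem Raise.exists_lift (hp : 1 ≤ p) {C D : FibPath p (n + 1)} {i : ℕ} (h : Raise C D i) :
    ∃ A B : FibPath p (n + 1 + 1), Raise A B i ∧ A.bond = C ∧ B.bond = D := by
  obtain ⟨hi, h1, h2⟩ := h
  obtain ⟨B, rfl, hB⟩ := exists_bond_eq_height_add_one hp D
  suffices ∃ A : FibPath p (n + 1 + 1), A.bond = C ∧ A.height (n + 1) = B.height (n + 1) by
    obtain ⟨A, rfl, hA⟩ := this
    refine ⟨A, B, ⟨by omega, ?_, fun j hj hji => ?_⟩, rfl, rfl⟩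
    · rwa [height_bond _ _ (by omega), height_bond _ _ (by omega)] at h1
    · rcases Nat.lt_or_ge j (n + 1) with hjn | hjn
      · rw [← height_bond A _ hjn, ← height_bond B _ hjn, h2 j (by omega) hji]
      · obtain rfl : j = n + 1 := by omega
        exact hA
  rcases eq_or_ne n i with rfl | hni
  · obtain ⟨A, hA, hA'⟩ := exists_bond_eq_height_eq hp C fun k j hk hj => by
      have hk0 : k ≠ 0 := by rintro rfl; simp [← hk] at hp
      have hn0 : 0 < n := by
        by_contra h0
        obtain rfl : n = 0 := by omega
        rw [height_zero, height_zero] at h1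
        omega
      rcases Nat.lt_or_ge j n with hjn | hjn
      · have h3 := B.bond.height_mono hjn.le
        rw [h2 j hjn.le hjn.ne]
        omega
      -- Here `p = 1`, so heights grow by exactly one at each step and a raise at `n` is impossible.
      · obtain rfl : k = 1 := by omega
        have h3 := B.bond.height_window 1 (n - 1) hk (by omega)
        have h4 := C.height_succ_le (n - 1) (by omega)
        rw [h2 (n - 1) (by omega) (by omega)] at h4
        rw [Nat.sub_add_cancel hn0] at h3 h4
        omega
    exact ⟨A, hA, by omega⟩
  · obtain ⟨A, hA, hA'⟩ := exists_bond_eq_height_add_one hp C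
    exact ⟨A, hA, by rw [hA', hB, h2 n le_rfl hni]⟩

end FibPath

open FibPath in
theorem fibGraph_edge_iff {p : ℕ∞} (hp : 1 ≤ p) {n : ℕ} (P Q : FibPath p (n + 1)) :
    (fibGraph p n).Edge P Q ↔ P = Q ∨ (∃ i, Raise P Q i) ∨ ∃ i, Raise Q P i := by
  rw [← covBy_iff_exists_raise hp, ← covBy_iff_exists_raise hp]
  rfl

theorem fibBond_isEpimorphism {p : ℕ∞} (hp : 1 ≤ p) (n : ℕ) :
    (fibGraph p (n + 1)).IsEpimorphism (fibGraph p n) (fibBond p n) where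
  map_edge P Q h := by
    rw [fibGraph_edge_iff hp] at h ⊢
    rcases h with rfl | ⟨i, h⟩ | ⟨i, h⟩
    · exact Or.inl rfl
    · exact h.bond.imp id fun h => Or.inl ⟨i, h⟩
    · exact h.bond.imp Eq.symm fun h => Or.inr ⟨i, h⟩
  surj_vertex P := (FibPath.exists_bond_eq_height_add_one hp P).imp fun _ h => h.1
  surj_edge C D h := by
    rw [fibGraph_edge_iff hp] at h
    rcases h with rfl | ⟨i, h⟩ | ⟨i, h⟩
    · obtain ⟨P, hP, -⟩ := FibPath.exists_bond_eq_height_add_one hp C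
      exact ⟨P, P, (fibGraph p (n + 1)).refl P, hP, hP⟩
    · obtain ⟨A, B, hAB, hA, hB⟩ := h.exists_lift hp
      exact ⟨A, B, (fibGraph_edge_iff hp A B).2 (Or.inr (Or.inl ⟨i, hAB⟩)), hA, hB⟩
    · obtain ⟨A, B, hAB, hA, hB⟩ := h.exists_lift hp
      exact ⟨B, A, (fibGraph_edge_iff hp B A).2 (Or.inr (Or.inr ⟨i, hAB⟩)), hB, hA⟩

theorem fibBond_isMonotoneEpi {p : ℕ∞} (hp : 1 ≤ p) (n : ℕ) :
    (fibGraph p (n + 1)).IsMonotoneEpi (fibGraph p n) (fibBond p n) :=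
  (fibBond_isEpimorphism hp n).isMonotoneEpi fun P Q h => by
    rw [fibGraph_edge_iff hp]
    exact (FibPath.eq_or_raise_of_bond_eq h).imp id
      (Or.imp (fun h => ⟨_, h⟩) (fun h => ⟨_, h⟩))

/-! ### Topology and connectedness of the limit -/

namespace InvSeq

open Filter Topology TopologicalSpace

variable {V : ℕ → Type*} {α : ∀ n, V (n + 1) → V n}

theorem IsComposite.apply_limit {m n : ℕ} {f : V m → V n} (hf : IsComposite α m n f)
    (x : Limit α) : f (x.1 m) = x.1 n := by
  induction hf with
  | id n => rfl
  | comp m n f _ ih => rw [Function.comp_apply, x.2 m, ih]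

theorem limit_eq_of_le {m n : ℕ} (h : n ≤ m) {x y : Limit α} (hxy : x.1 m = y.1 m) :
    x.1 n = y.1 n := by
  obtain ⟨f, hf⟩ := exists_isComposite α h
  rw [← hf.apply_limit, ← hf.apply_limit, hxy]

/-- The projections of the limit of an inverse sequence of surjections are surjective. -/
theorem exists_limit_apply_eq (hα : ∀ n, Function.Surjective (α n)) (n : ℕ) (c : V n) :
    ∃ x : Limit α, x.1 n = c := by
  choose s hs using hα
  let y : ∀ k, V (n + k) := fun k => Nat.rec c (fun k z => s (n + k) z) k
  have hy : ∀ k, α (n + k) (y (k + 1)) = y k := fun k => hs (n + k) (y k)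
  -- Coordinate `m` of the thread is the image of `y m`, which lives at stage `n + m ≥ m`; this
  -- avoids distinguishing `m ≤ n` from `m > n`.
  choose φ hφ using fun m => exists_isComposite α (Nat.le_add_left m n)
  have key : ∀ k, ∀ f, IsComposite α (n + k) n f → f (y k) = c := by
    intro k
    induction k with
    | zero =>
      intro f hf
      rw [hf.unique (.id n)]
      rfl
    | succ k ih =>
      intro f hf
      obtain ⟨g, hg⟩ := exists_isComposite α (Nat.le_add_right n k)
      rw [hf.unique hg.comp, Function.comp_apply]
      exact (congrArg g (hy k)).trans (ih g hg)
  refine ⟨⟨fun m => φ m (y m), fun m => ?_⟩, key n _ (hφ n)⟩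
  have h1 := ((hφ (m + 1)).trans (.bond m)).unique (hφ m).comp
  exact (congrFun h1 (y (m + 1))).trans (congrArg (φ m) (hy m))

section Topology

variable [∀ n, TopologicalSpace (V n)]

theorem continuous_limit_apply (n : ℕ) : Continuous fun x : Limit α => x.1 n :=
  (continuous_apply n).comp continuous_subtype_val

variable [∀ n, DiscreteTopology (V n)]

theorem isClosed_setOf_limit_apply (n : ℕ) (Q : Set (V n)) :
    IsClosed {x : Limit α | x.1 n ∈ Q} :=
  (isClosed_discrete Q).preimage (continuous_limit_apply n)

theorem isClosed_setOf_edge (G : ∀ n, ReflGraph (V n)) (n : ℕ) :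
    IsClosed {e : Limit α × Limit α | (G n).Edge (e.1.1 n) (e.2.1 n)} :=
  (isClosed_discrete {e : V n × V n | (G n).Edge e.1 e.2}).preimage
    (((continuous_limit_apply n).comp continuous_fst).prodMk
      ((continuous_limit_apply n).comp continuous_snd))

theorem connectedSet_image {G : ∀ n, ReflGraph (V n)} {K : Set (Limit α)}
    (hK : (limitGraph G α).ConnectedSet K) (n : ℕ) :
    (G n).ConnectedSet ((fun x => x.1 n) '' K) := by
  rintro ⟨A, B, -, -, hAB, ⟨a, ⟨x, hx, rfl⟩, ha⟩, ⟨b, ⟨y, hy, rfl⟩, hb⟩, hdisj, hedge⟩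
  refine hK ⟨{x | x.1 n ∈ A}, {x | x.1 n ∈ B},
    (isClosed_discrete A).preimage (continuous_limit_apply n),
    (isClosed_discrete B).preimage (continuous_limit_apply n),
    fun z hz => hAB ⟨z, hz, rfl⟩, ⟨x, hx, ha⟩, ⟨y, hy, hb⟩, ?_, ?_⟩
  · rw [Set.disjoint_left] at hdisj ⊢
    exact fun z hz hz' => hdisj ⟨⟨z, hz.1, rfl⟩, hz.2⟩ ⟨⟨z, hz'.1, rfl⟩, hz'.2⟩
  · exact fun z hz w hw he => hedge _ ⟨⟨z, hz.1, rfl⟩, hz.2⟩ _ ⟨⟨w, hw.1, rfl⟩, hw.2⟩ (he n)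

variable [∀ n, Finite (V n)]

theorem isClosed_range_limit :
    IsClosed {x : ∀ n, V n | ∀ n, α n (x (n + 1)) = x n} := by
  rw [Set.ofPred_forall]
  exact isClosed_iInter fun n => isClosed_eq
    (continuous_of_discreteTopology.comp (continuous_apply (n + 1))) (continuous_apply n)

instance : CompactSpace (Limit α) :=
  isCompact_iff_compactSpace.1 isClosed_range_limit.isCompact

instance : T2Space (Limit α) :=
  inferInstanceAs (T2Space {x : ∀ n, V n // ∀ n, α n (x (n + 1)) = x n})

instance : TotallyDisconnectedSpace (Limit α) :=
  inferInstanceAs (TotallyDisconnectedSpace {x : ∀ n, V n // ∀ n, α n (x (n + 1)) = x n})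

instance : SecondCountableTopology (Limit α) :=
  have (n : ℕ) : SecondCountableTopology (V n) :=
    DiscreteTopology.secondCountableTopology_of_countable
  Subtype.secondCountableTopology {x : ∀ n, V n | ∀ n, α n (x (n + 1)) = x n}

theorem isTopologicalGraph_limitGraph (G : ∀ n, ReflGraph (V n)) :
    (limitGraph G α).IsTopologicalGraph where
  compact := inferInstance
  t2 := inferInstance
  zero_dim := inferInstance
  second_countable := inferInstance
  closed_edge := by
    change IsClosed {e : Limit α × Limit α | ∀ n, (G n).Edge (e.1.1 n) (e.2.1 n)}
    rw [Set.ofPred_forall]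
    exact isClosed_iInter (isClosed_setOf_edge G)

/-- Closed sets of vertices that are joined by no edge of the limit are joined by no edge already
at some finite stage. -/
theorem exists_forall_not_edge {G : ∀ n, ReflGraph (V n)}
    (hα : ∀ n, (G (n + 1)).IsEpimorphism (G n) (α n)) {A B : Set (Limit α)} (hA : IsClosed A)
    (hB : IsClosed B) (h : ∀ a ∈ A, ∀ b ∈ B, ¬ (limitGraph G α).Edge a b) :
    ∃ N, ∀ m ≥ N, ∀ a ∈ A, ∀ b ∈ B, ¬ (G m).Edge (a.1 m) (b.1 m) := by
  -- The edge relation of the limit is the intersection of the decreasing stagewise relations, so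
  -- compactness produces an edge of the limit if every `T m` is nonempty.
  let T : ℕ → Set (Limit α × Limit α) := fun m =>
    A ×ˢ B ∩ {e | (G m).Edge (e.1.1 m) (e.2.1 m)}
  have hT : ∀ m, T (m + 1) ⊆ T m := fun m e he => ⟨he.1, by
    have := (hα m).map_edge _ _ he.2
    rwa [e.1.2 m, e.2.2 m] at this⟩
  have hcl : ∀ m, IsClosed (T m) := fun m => (hA.prod hB).inter (isClosed_setOf_edge G m)
  by_contra! hc
  have hne : ∀ m, (T m).Nonempty := fun m => by
    obtain ⟨k, hk, a, ha, b, hb, hab⟩ := hc m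
    exact ⟨(a, b), antitone_nat_of_succ_le hT hk ⟨⟨ha, hb⟩, hab⟩⟩
  obtain ⟨e, he⟩ := IsCompact.nonempty_iInter_of_sequence_nonempty_isCompact_isClosed T hT hne
    (hcl 0).isCompact hcl
  rw [Set.mem_iInter] at he
  exact h e.1 (he 0).1.1 e.2 (he 0).1.2 fun n => (he n).2

/-- The projections of the limit of an inverse sequence of finite graphs and monotone epimorphisms
are monotone. -/
theorem connectedSet_preimage {G : ∀ n, ReflGraph (V n)}
    (hα : ∀ n, (G (n + 1)).IsMonotoneEpi (G n) (α n)) (n : ℕ) {Q : Set (V n)}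
    (hQ : (G n).ConnectedSet Q) : (limitGraph G α).ConnectedSet {x | x.1 n ∈ Q} := by
  rintro ⟨A, B, hA, hB, hAB, ⟨a, ha⟩, ⟨b, hb⟩, -, hedge⟩
  set S : Set (Limit α) := {x | x.1 n ∈ Q} with hS
  have hScl : IsClosed S := isClosed_setOf_limit_apply n Q
  obtain ⟨N, hN⟩ := exists_forall_not_edge (fun n => (hα n).epi) (hScl.inter hA) (hScl.inter hB)
    hedge
  obtain ⟨m, hnm, hNm⟩ : ∃ m, n ≤ m ∧ N ≤ m := ⟨max n N, le_max_left n N, le_max_right n N⟩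
  obtain ⟨f, hf⟩ := exists_isComposite α hnm
  replace hN := hN m hNm
  have hfS : ∀ x : Limit α, x.1 m ∈ f ⁻¹' Q ↔ x ∈ S := fun x => by
    rw [Set.mem_preimage, hf.apply_limit, hS, Set.mem_ofPred]
  -- The projections of the two halves to a stage `m` where no edge joins them would separate `f ⁻¹'
  -- Q`. Their disjointness follows from the loops.
  refine (hf.isMonotoneEpi hα).monotone Q (isClosed_discrete Q) hQ
    ⟨(fun x => x.1 m) '' (S ∩ A), (fun x => x.1 m) '' (S ∩ B), isClosed_discrete _,
      isClosed_discrete _, fun c hc => ?_, ⟨a.1 m, (hfS a).2 ha.1, a, ha, rfl⟩,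
      ⟨b.1 m, (hfS b).2 hb.1, b, hb, rfl⟩, ?_, ?_⟩
  · obtain ⟨x, rfl⟩ := exists_limit_apply_eq (fun n => (hα n).epi.surj_vertex) m c
    have hx := (hfS x).1 hc
    exact (hAB hx).imp (fun h => ⟨x, ⟨hx, h⟩, rfl⟩) (fun h => ⟨x, ⟨hx, h⟩, rfl⟩)
  · rw [Set.disjoint_left]
    rintro c ⟨-, x, hx, rfl⟩ ⟨-, y, hy, hxy⟩
    refine hN x hx y hy ?_
    simp only at hxy
    rw [hxy]
    exact (G m).refl _
  · rintro c ⟨-, x, hx, rfl⟩ d ⟨-, y, hy, rfl⟩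
    exact hN x hx y hy

/-! ### Cylinders and the Kelley property -/

/-- The set of the points with the same `n`-th coordinate as some point of `K`. -/
def cylinder (K : NonemptyCompacts (Limit α)) (n : ℕ) : NonemptyCompacts (Limit α) where
  carrier := {x | x.1 n ∈ (fun x => x.1 n) '' (K : Set (Limit α))}
  isCompact' := (isClosed_setOf_limit_apply n _).isCompact
  nonempty' := K.nonempty.mono fun x hx => ⟨x, hx, rfl⟩

theorem mem_cylinder {K : NonemptyCompacts (Limit α)} {n : ℕ} {x : Limit α} :
    x ∈ cylinder K n ↔ ∃ y ∈ K, y.1 n = x.1 n := Iff.rfl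

theorem subset_cylinder (K : NonemptyCompacts (Limit α)) (n : ℕ) :
    (K : Set (Limit α)) ⊆ cylinder K n := fun x hx => mem_cylinder.2 ⟨x, hx, rfl⟩

theorem cylinder_antitone (K : NonemptyCompacts (Limit α)) :
    Antitone fun n => (cylinder K n : Set (Limit α)) := by
  intro n m hnm x hx
  obtain ⟨y, hy, hyx⟩ := mem_cylinder.1 hx
  exact mem_cylinder.2 ⟨y, hy, limit_eq_of_le hnm hyx⟩

/-- The points of `K` agreeing with `z` at stage `n` form nested nonempty compact sets; a common
point must be `z`. -/
theorem mem_of_forall_mem_cylinder {K : NonemptyCompacts (Limit α)} {z : Limit α}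
    (hz : ∀ n, z ∈ cylinder K n) : z ∈ K := by
  obtain ⟨y, hy⟩ := IsCompact.nonempty_iInter_of_sequence_nonempty_isCompact_isClosed
    (fun n => (K : Set (Limit α)) ∩ {y | y.1 n ∈ ({z.1 n} : Set (V n))})
    (fun n y hy => ⟨hy.1, limit_eq_of_le (Nat.le_succ n) hy.2⟩)
    (fun n => (mem_cylinder.1 (hz n)).imp fun y hy => ⟨hy.1, hy.2⟩)
    (K.isCompact.inter_right (isClosed_setOf_limit_apply 0 _))
    (fun n => K.isCompact.isClosed.inter (isClosed_setOf_limit_apply n _))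
  rw [Set.mem_iInter] at hy
  obtain rfl : y = z := Subtype.ext (funext fun n => (hy n).2)
  exact (hy 0).1

theorem exists_cylinder_subset (K : NonemptyCompacts (Limit α)) {U : Set (Limit α)}
    (hU : IsOpen U) (hKU : (K : Set (Limit α)) ⊆ U) :
    ∃ N, (cylinder K N : Set (Limit α)) ⊆ U := by
  by_contra! hc
  have hcl : ∀ n, IsClosed ((cylinder K n : Set (Limit α)) ∩ Uᶜ) := fun n =>
    (cylinder K n).isCompact.isClosed.inter hU.isClosed_compl
  obtain ⟨z, hz⟩ := IsCompact.nonempty_iInter_of_sequence_nonempty_isCompact_isClosed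
    (fun n => (cylinder K n : Set (Limit α)) ∩ Uᶜ)
    (fun n => Set.inter_subset_inter_left _ (cylinder_antitone K (Nat.le_succ n)))
    (fun n => Set.not_subset.1 (hc n)) (hcl 0).isCompact hcl
  rw [Set.mem_iInter] at hz
  exact (hz 0).2 (hKU (mem_of_forall_mem_cylinder fun n => (hz n).1))

/-- The limit of an inverse sequence of finite graphs and monotone epimorphisms that starts with a
single vertex is Kelley. -/
theorem isKelley_limitGraph [Nonempty (V 0)] [Subsingleton (V 0)] {G : ∀ n, ReflGraph (V n)}
    (hα : ∀ n, (G (n + 1)).IsMonotoneEpi (G n) (α n)) : (limitGraph G α).IsKelley where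
  topGraph := isTopologicalGraph_limitGraph G
  nonempty := by
    obtain ⟨c⟩ := ‹Nonempty (V 0)›
    exact (exists_limit_apply_eq (fun n => (hα n).epi.surj_vertex) 0 c).nonempty
  connected := by
    have h0 : (G 0).ConnectedSet Set.univ := by
      rintro ⟨A, B, -, -, -, ⟨a, ha⟩, ⟨b, hb⟩, hdisj, -⟩
      obtain rfl := Subsingleton.elim a b
      exact Set.disjoint_left.1 hdisj ha hb
    exact connectedSet_preimage hα 0 h0
  kelley := by
    classical
    intro K hK x hx xs hxs
    -- The bound `k` makes the greatest stage of agreement exist even if `xs k = x`; the default `0`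
    -- is a stage of agreement because `V 0` is a single point.
    let m : ℕ → ℕ := fun k => Nat.findGreatest (fun m => (xs k).1 m = x.1 m) k
    have hm : ∀ k, (xs k).1 (m k) = x.1 (m k) := fun k =>
      Nat.findGreatest_spec (P := fun m => (xs k).1 m = x.1 m) (Nat.zero_le k)
        (Subsingleton.elim _ _)
    refine ⟨fun k => cylinder K (m k), fun k => ⟨connectedSet_preimage hα _
      (connectedSet_image hK _), mem_cylinder.2 ⟨x, hx, (hm k).symm⟩⟩, ?_⟩
    rw [NonemptyCompacts.isTopologicalBasis.nhds_hasBasis.tendsto_right_iff]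
    rintro _ ⟨⟨u, ⟨-, -, hu⟩, rfl⟩, hKu⟩
    obtain ⟨N, hN⟩ := exists_cylinder_subset K (isOpen_sUnion hu) hKu.1
    have hev : ∀ᶠ k in atTop, (xs k).1 N = x.1 N :=
      ((continuous_limit_apply N).tendsto x).comp hxs (isOpen_discrete {x.1 N} |>.mem_nhds rfl)
    filter_upwards [hev, eventually_ge_atTop N] with k hk hNk
    have hNm : N ≤ m k := Nat.le_findGreatest hNk hk
    -- A basic Vietoris neighbourhood asks for containment in a union and for meeting each member;
    -- the latter is inherited because cylinders contain `K`.
    exact ⟨(cylinder_antitone K hNm).trans hN, fun U hU =>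
      (hKu.2 U hU).mono (Set.inter_subset_inter_left _ (subset_cylinder K _))⟩

end Topology

end InvSeq

theorem mainTheorem6 (p : ℕ∞) (hp : 1 ≤ p) :
    -- each poset is a lattice
    (∀ n : ℕ, 1 ≤ n → ∀ P Q : FibPath p n,
      (∃ J, IsLUB {P, Q} J) ∧ ∃ M, IsGLB {P, Q} M) ∧
    -- the Hasse diagrams with the composites of the bonding maps form a projective Fraïssé family
    ReflGraph.IsProjectiveFraisse (fibGraph p)
      (InvSeq.Composites (V := fun n => FibPath p (n + 1)) (fibBond p)) ∧
    -- whose bonding maps, and all their composites, are monotone epimorphisms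
    (∀ n, (fibGraph p (n + 1)).IsMonotoneEpi (fibGraph p n) (fibBond p n)) ∧
    (∀ m n, ∀ f ∈ InvSeq.Composites (V := fun n => FibPath p (n + 1)) (fibBond p) m n,
      (fibGraph p m).IsMonotoneEpi (fibGraph p n) f) ∧
    -- and the inverse limit is Kelley
    (InvSeq.limitGraph (V := fun n => FibPath p (n + 1)) (fibGraph p) (fibBond p)).IsKelley := by
  have : Nonempty (FibPath p (0 + 1)) := FibPath.nonempty_one hp
  have : Subsingleton (FibPath p (0 + 1)) := ⟨fun P Q => FibPath.ext_height fun i hi => by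
    obtain rfl : i = 0 := by omega
    rw [FibPath.height_zero, FibPath.height_zero]⟩
  refine ⟨fun n hn P Q => ?_, InvSeq.isProjectiveFraisse (fibBond_isEpimorphism hp),
    fibBond_isMonotoneEpi hp, fun m n f hf => ?_,
    InvSeq.isKelley_limitGraph (V := fun n => FibPath p (n + 1)) (fibBond_isMonotoneEpi hp)⟩
  · obtain ⟨n, rfl⟩ : ∃ k, n = k + 1 := ⟨n - 1, by omega⟩
    exact ⟨FibPath.exists_isLUB hp P Q, FibPath.exists_isGLB hp P Q⟩
  · exact InvSeq.IsComposite.isMonotoneEpi (V := fun n => FibPath p (n + 1))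
      (fibBond_isMonotoneEpi hp) hf
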